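/- All rings are associative with identity. A ring $R$ is called clean if every element of $R$ is the sum of an idempotent and a unit. Idempotents $e,f\in R$ are called equivalent, $e\sim f$, if $e=u^{-1}fu$ for some unit $u$ of $R$. The ring $R$ is called unit uniquely clean (UnitUC) if it is clean and, whenever $e+u=f+v$ with $e,f\in R$ idempotents and $u,v\in R$ units, one has $e\sim f$. For $n\ge 2$ and an element $s$ of the center $C(R)$, the formal matrix ring $M_n(R;s)$ is the set of all $n\times n$ matrices over $R$ with the usual addition and with the multiplication $$(a_{ij})(b_{ij})=(c_{ij}),\qquad c_{ij}=\sum_{k=1}^{n}s^{\delta_{ikj}}\,a_{ik}b_{kj},\qquad \delta_{ijk}=1+\delta_{ik}-\delta_{ij}-\delta_{jk},$$ where $\delta_{ij}$ is the Kronecker delta (and $s^0=1$). Let $J(R)$ denote the Jacobson radical of $R$. Theorem. Let $R$ be a ring, $s\in C(R)$ and $n\ge 2$. Then $M_n(R;s)$ is UnitUC if and only if $R$ is UnitUC and $s\in J(R)$. -/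

import Mathlib

/-- A ring is clean if every element is the sum of an idempotent and a unit. -/
def IsCleanRing (R : Type*) [Ring R] : Prop :=
  ∀ a : R, ∃ e u : R, IsIdempotentElem e ∧ IsUnit u ∧ a = e + u

/-- Equivalence `e ∼ f` of elements of a ring: `e = u⁻¹ f u` for some unit `u`. -/
def UnitEquiv {R : Type*} [Ring R] (e f : R) : Prop :=
  ∃ u : Rˣ, e = (↑u⁻¹ : R) * f * (u : R)

/-- A unit uniquely clean ring: it is clean, and the idempotents occurring in any two
clean representations of the same element are equivalent. -/
structure IsUnitUC (R : Type*) [Ring R] : Prop where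
  clean : IsCleanRing R
  unique : ∀ e f u v : R, IsIdempotentElem e → IsIdempotentElem f → IsUnit u → IsUnit v →
    e + u = f + v → UnitEquiv e f

/-- The Kronecker delta. -/
def kronecker {n : ℕ} (i j : Fin n) : ℕ := if i = j then 1 else 0

/-- The exponent `δ_{ijk} = 1 + δ_{ik} - δ_{ij} - δ_{jk}`; the subtraction never truncates,
see `cast_deltaExp`. -/
def deltaExp {n : ℕ} (i j k : Fin n) : ℕ :=
  1 + kronecker i k - kronecker i j - kronecker j k

theorem cast_deltaExp {n : ℕ} (i j k : Fin n) :
    (deltaExp i j k : ℤ) = 1 + kronecker i k - kronecker i j - kronecker j k := by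
  unfold deltaExp kronecker
  by_cases h1 : i = j <;> by_cases h2 : j = k <;> by_cases h3 : i = k <;> simp_all

theorem deltaExp_assoc {n : ℕ} (i l k j : Fin n) :
    deltaExp i k j + deltaExp i l k = deltaExp i l j + deltaExp l k j := by
  have h1 := cast_deltaExp i k j
  have h2 := cast_deltaExp i l k
  have h3 := cast_deltaExp i l j
  have h4 := cast_deltaExp l k j
  omega

/-- The underlying type of the formal matrix ring `M_n(R; s)`: all `n × n` matrices over `R`.
It is a separate type because its multiplication is not the usual one. -/
def FormalMatrix (n : ℕ) (R : Type*) [Ring R] (_s : Subring.center R) : Type _ :=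
  Matrix (Fin n) (Fin n) R

namespace FormalMatrix

variable {n : ℕ} {R : Type*} [Ring R] {s : Subring.center R}

/-- Addition is the usual (entrywise) addition of matrices. -/
instance : AddCommGroup (FormalMatrix n R s) :=
  inferInstanceAs (AddCommGroup (Matrix (Fin n) (Fin n) R))

/-- The twisted product `c_{ij} = ∑ₖ s ^ δ_{ikj} a_{ik} b_{kj}`. -/
instance : Mul (FormalMatrix n R s) :=
  ⟨fun a b => fun i j => ∑ k, (s : R) ^ deltaExp i k j * a i k * b k j⟩

/-- The identity is the usual identity matrix. -/
instance : One (FormalMatrix n R s) :=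
  ⟨(1 : Matrix (Fin n) (Fin n) R)⟩

theorem ext {a b : FormalMatrix n R s} (h : ∀ i j, a i j = b i j) : a = b :=
  funext fun i => funext fun j => h i j

theorem add_apply (a b : FormalMatrix n R s) (i j : Fin n) : (a + b) i j = a i j + b i j := rfl

theorem zero_apply (i j : Fin n) : (0 : FormalMatrix n R s) i j = 0 := rfl

theorem mul_apply (a b : FormalMatrix n R s) (i j : Fin n) :
    (a * b) i j = ∑ k, (s : R) ^ deltaExp i k j * a i k * b k j := rfl

theorem one_apply (i j : Fin n) :
    (1 : FormalMatrix n R s) i j = if i = j then 1 else 0 := Matrix.one_apply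

theorem pow_comm (s : Subring.center R) (m : ℕ) (x : R) :
    x * (s : R) ^ m = (s : R) ^ m * x :=
  (Subring.mem_center_iff.1 (pow_mem s.2 m)) x

theorem deltaExp_self_left (i j : Fin n) : deltaExp i i j = 0 := by
  have := cast_deltaExp i i j
  simp [kronecker] at this
  omega

theorem deltaExp_self_right (i j : Fin n) : deltaExp i j j = 0 := by
  have := cast_deltaExp i j j
  simp [kronecker] at this
  omega

protected theorem mul_assoc (a b c : FormalMatrix n R s) : a * b * c = a * (b * c) := by
  apply ext
  intro i j
  simp only [mul_apply, Finset.mul_sum, Finset.sum_mul]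
  rw [Finset.sum_comm]
  refine Finset.sum_congr rfl fun l _ => Finset.sum_congr rfl fun k _ => ?_
  calc (s : R) ^ deltaExp i k j * ((s : R) ^ deltaExp i l k * a i l * b l k) * c k j
      = (s : R) ^ (deltaExp i k j + deltaExp i l k) * (a i l * b l k * c k j) := by
        rw [pow_add]; simp only [mul_assoc]
    _ = (s : R) ^ deltaExp i l j * ((s : R) ^ deltaExp l k j * a i l) * b l k * c k j := by
        rw [deltaExp_assoc, pow_add]; simp only [mul_assoc]
    _ = (s : R) ^ deltaExp i l j * a i l * ((s : R) ^ deltaExp l k j * b l k * c k j) := by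
        rw [← pow_comm s _ (a i l)]; simp only [mul_assoc]

/-- The formal matrix ring `M_n(R; s)`. -/
instance : Ring (FormalMatrix n R s) :=
  { (inferInstance : AddCommGroup (FormalMatrix n R s)),
    (inferInstance : Mul (FormalMatrix n R s)),
    (inferInstance : One (FormalMatrix n R s)) with
    mul_assoc := FormalMatrix.mul_assoc
    one_mul := fun a => ext fun i j => by
      simp [mul_apply, one_apply, deltaExp_self_left]
    mul_one := fun a => ext fun i j => by
      simp [mul_apply, one_apply, deltaExp_self_right]
    zero_mul := fun a => ext fun i j => by simp [mul_apply, zero_apply]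
    mul_zero := fun a => ext fun i j => by simp [mul_apply, zero_apply]
    left_distrib := fun a b c => ext fun i j => by
      simp [mul_apply, add_apply, mul_add, Finset.sum_add_distrib]
    right_distrib := fun a b c => ext fun i j => by
      simp [mul_apply, add_apply, mul_add, add_mul, Finset.sum_add_distrib] }

end FormalMatrix

/-! ### Units and the Jacobson radical. -/

namespace Ring

variable {R : Type*} [Ring R]

/-! Everything reduces to `isUnitUC_iff_isJacobsonClean`: unit unique cleanness means that each
element is an idempotent plus an element of the radical J, i.e. the quotient by J is Boolean and
idempotents lift. The hard direction plays outer inverses, available in clean rings, against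
`IsUnitUC.eq_zero_of_isUnit_sub`: square-zero elements fall into J, so idempotents are central
modulo J, and then every unit is congruent to 1. For formal matrices with s in J(R), subtracting a
diagonal of idempotents already leaves an element of the radical (`FormalMatrix.isJacobsonClean`).
Conversely, the property descends to the corner R, and the square-zero matrix units satisfy E_ij
E_ji = s² E_ii, which forces s² and hence s into J(R). -/

theorem mem_jacobson_iff_exists_left_inv {x : R} :
    x ∈ jacobson R ↔ ∀ y, ∃ z, z * (1 + y * x) = 1 := by
  rw [← Ideal.jacobson_bot, Ideal.mem_jacobson_iff]
  refine forall_congr' fun y => exists_congr fun z => ?_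
  rw [Ideal.mem_bot, sub_eq_zero, mul_add, mul_one, mul_assoc, add_comm]

theorem isUnit_one_add_of_mem_jacobson {x : R} (hx : x ∈ jacobson R) : IsUnit (1 + x) := by
  obtain ⟨z, hz⟩ := mem_jacobson_iff_exists_left_inv.1 hx 1
  rw [one_mul] at hz
  -- Since z = 1 - z x, the left inverse z has a left inverse itself, so it is two-sided.
  obtain ⟨w, hw⟩ := mem_jacobson_iff_exists_left_inv.1 hx (-z)
  have h : 1 + -z * x = z := by
    rw [mul_add, mul_one] at hz
    rw [neg_mul, ← sub_eq_add_neg, ← eq_sub_of_add_eq hz]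
  rw [h] at hw
  have h' : w = 1 + x := left_inv_eq_right_inv hw hz
  exact ⟨⟨1 + x, z, h' ▸ hw, hz⟩, rfl⟩

theorem mk_jacobson_eq_zero {x : R} :
    Ideal.Quotient.mk (jacobson R) x = 0 ↔ x ∈ jacobson R :=
  Ideal.Quotient.eq_zero_iff_mem

theorem isUnit_of_isUnit_mk_jacobson {x : R} (hx : IsUnit (Ideal.Quotient.mk (jacobson R) x)) :
    IsUnit x := by
  obtain ⟨u, hu⟩ := hx
  obtain ⟨y, hy⟩ := Ideal.Quotient.mk_surjective (↑u⁻¹ : R ⧸ jacobson R)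
  have key : ∀ t : R, Ideal.Quotient.mk (jacobson R) t = 1 → IsUnit t := fun t ht => by
    have : t - 1 ∈ jacobson R := by
      rw [← mk_jacobson_eq_zero, map_sub, ht, map_one, sub_self]
    simpa using isUnit_one_add_of_mem_jacobson this
  obtain ⟨a, ha⟩ := key (x * y) (by rw [map_mul, ← hu, hy, Units.mul_inv])
  obtain ⟨b, hb⟩ := key (y * x) (by rw [map_mul, ← hu, hy, Units.inv_mul])
  refine isUnit_iff_exists_and_exists.2 ⟨⟨y * ↑a⁻¹, ?_⟩, ⟨↑b⁻¹ * y, ?_⟩⟩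
  · rw [← mul_assoc, ← ha, Units.mul_inv]
  · rw [mul_assoc, ← hb, Units.inv_mul]

end Ring

open Ring

/-! ### Unit uniquely clean rings and their quotient by the radical. -/

section Clean

variable {R : Type*} [Ring R]

/-- A ring in which every element is the sum of an idempotent and an element of the Jacobson
radical. -/
def IsJacobsonClean (R : Type*) [Ring R] : Prop :=
  ∀ a : R, ∃ e : R, IsIdempotentElem e ∧ a - e ∈ jacobson R

/-- Idempotents which are congruent modulo the Jacobson radical are equivalent. -/
theorem unitEquiv_of_sub_mem_jacobson {e f : R} (he : IsIdempotentElem e)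
    (hf : IsIdempotentElem f) (h : e - f ∈ jacobson R) : UnitEquiv e f := by
  have hw : IsUnit (e * f + (1 - e) * (1 - f)) := by
    apply isUnit_of_isUnit_mk_jacobson
    have h' : Ideal.Quotient.mk (jacobson R) e = Ideal.Quotient.mk (jacobson R) f :=
      Ideal.Quotient.eq.2 h
    have hf' := hf.map (Ideal.Quotient.mk (jacobson R))
    rw [map_add, map_mul, map_mul, map_sub, map_sub, map_one, h', hf'.eq, hf'.one_sub.eq,
      add_sub_cancel]
    exact isUnit_one
  obtain ⟨w, hw⟩ := hw
  have h1 : e * w = w * f := by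
    rw [hw, mul_add, add_mul, ← mul_assoc, he.eq, ← mul_assoc, he.mul_one_sub_self, zero_mul,
      mul_assoc, hf.eq, mul_assoc, hf.one_sub_mul_self, mul_zero]
  refine ⟨w⁻¹, ?_⟩
  rw [inv_inv, ← h1, mul_assoc, Units.mul_inv, mul_one]

theorem IsJacobsonClean.isIdempotentElem_mk (h : IsJacobsonClean R) (a : R) :
    IsIdempotentElem (Ideal.Quotient.mk (jacobson R) a) := by
  obtain ⟨e, he, hj⟩ := h a
  rw [Ideal.Quotient.eq.2 hj]
  exact he.map _

theorem IsJacobsonClean.mk_unit (h : IsJacobsonClean R) {u : R} (hu : IsUnit u) :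
    Ideal.Quotient.mk (jacobson R) u = 1 :=
  (hu.map _).mul_left_cancel (by rw [(h.isIdempotentElem_mk u).eq, mul_one])

theorem IsJacobsonClean.isUnitUC (h : IsJacobsonClean R) : IsUnitUC R where
  clean a := by
    obtain ⟨e, he, hj⟩ := h (a - 1)
    exact ⟨e, 1 + (a - 1 - e), he, isUnit_one_add_of_mem_jacobson hj, by abel⟩
  unique e f u v he hf hu hv h' := by
    refine unitEquiv_of_sub_mem_jacobson he hf ?_
    rw [← mk_jacobson_eq_zero, show e - f = v - u from by
      rw [sub_eq_sub_iff_add_eq_add, h', add_comm], map_sub, h.mk_unit hu, h.mk_unit hv, sub_self]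

/-- The exchange property of clean rings. -/
theorem IsCleanRing.exists_isIdempotentElem (h : IsCleanRing R) (x : R) :
    ∃ a b : R, IsIdempotentElem (a * x) ∧ 1 - a * x = b * (1 - x) := by
  obtain ⟨e, _, he, ⟨u, rfl⟩, rfl⟩ := h x
  have h1 : (1 - ↑u⁻¹ * (e + u - 1)) * (e + u) = ↑u⁻¹ * (1 - e) * (u : R) := by
    simp only [mul_add, add_mul, mul_sub, sub_mul, mul_assoc, he.eq, one_mul, mul_one,
      Units.inv_mul]
    abel
  -- The first witness is chosen so that a x is the conjugate u⁻¹ (1 - e) u.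
  refine ⟨1 - ↑u⁻¹ * (e + u - 1), 1 - ↑u⁻¹ * (e + u), ?_, ?_⟩
  · rw [h1, IsIdempotentElem]
    calc ↑u⁻¹ * (1 - e) * (u : R) * (↑u⁻¹ * (1 - e) * u)
        = ↑u⁻¹ * ((1 - e) * (1 - e)) * u := by
          simp only [mul_assoc, Units.mul_inv_cancel_left]
      _ = _ := by rw [he.one_sub.eq]
  · noncomm_ring

/-- In a clean ring, every element outside the Jacobson radical has a nonzero outer inverse. -/
theorem IsCleanRing.exists_outer_inverse (h : IsCleanRing R) {x : R} (hx : x ∉ jacobson R) :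
    ∃ y : R, y ≠ 0 ∧ y * x * y = y := by
  rw [mem_jacobson_iff_exists_left_inv] at hx
  push Not at hx
  obtain ⟨z, hz⟩ := hx
  obtain ⟨a, b, hf, hb⟩ := h.exists_isIdempotentElem (-z * x)
  -- If this idempotent vanished, b would be a left inverse of 1 + z x.
  have hf0 : a * (-z * x) ≠ 0 := fun h0 => by
    refine hz b ?_
    rw [h0, sub_zero, neg_mul, sub_neg_eq_add] at hb
    exact hb.symm
  refine ⟨a * (-z * x) * (a * -z), fun h0 => hf0 ?_, ?_⟩
  · rw [← hf.eq]
    calc _ = a * (-z * x) * (a * -z) * x := by simp only [mul_assoc]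
      _ = 0 := by rw [h0, zero_mul]
  · calc _ = (a * (-z * x)) * (a * (-z * x)) * (a * (-z * x)) * (a * -z) := by
          simp only [mul_assoc]
      _ = _ := by rw [hf.eq, hf.eq]

/-- Compare the clean decompositions e + (u - e) = 0 + u: only 0 is equivalent to 0. -/
theorem IsUnitUC.eq_zero_of_isUnit_sub (h : IsUnitUC R) {e u : R} (he : IsIdempotentElem e)
    (hu : IsUnit u) (hue : IsUnit (u - e)) : e = 0 := by
  obtain ⟨w, hw⟩ := h.unique e 0 (u - e) u he .zero hue hu (by abel)
  rw [hw, mul_zero, zero_mul]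

/-- A unit uniquely clean ring contains no nonzero system of `2 × 2` matrix units. -/
theorem IsUnitUC.eq_zero_of_matrix_units (h : IsUnitUC R) {p q : R} (hp : p * p = 0)
    (hq : q * q = 0) (hpq : p * q * p = p) (hqp : q * p * q = q) : p = 0 := by
  have hp' : ∀ x, p * (p * x) = 0 := fun x => by rw [← mul_assoc, hp, zero_mul]
  have hq' : ∀ x, q * (q * x) = 0 := fun x => by rw [← mul_assoc, hq, zero_mul]
  have hpq1 : p * (q * p) = p := by rw [← mul_assoc, hpq]
  have hqp1 : q * (p * q) = q := by rw [← mul_assoc, hqp]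
  have hpq' : ∀ x, p * (q * (p * x)) = p * x := fun x => by simp only [← mul_assoc, hpq]
  have hqp' : ∀ x, q * (p * (q * x)) = q * x := fun x => by simp only [← mul_assoc, hqp]
  have he : IsIdempotentElem (p * q + q * p) := by
    simp only [IsIdempotentElem, mul_add, add_mul, mul_assoc, hp', hq', hpq', hqp',
      mul_zero, add_zero, zero_add]
  -- In the corner of p q + q p, the two elements are [[1,1],[1,0]] and [[0,1],[1,-1]]: mutually
  -- inverse, with difference the identity. On the complement both are 1.
  have hsub : 1 + p + q - q * p - (p * q + q * p) = 1 + p + q - p * q - q * p - q * p := by abel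
  have h1 : (1 + p + q - q * p) * (1 + p + q - p * q - q * p - q * p) = 1 := by
    simp only [mul_add, add_mul, mul_sub, sub_mul, mul_assoc, hp', hq', hp, hq,
      hpq1, hqp1, mul_zero, add_zero, one_mul, mul_one, sub_zero]
    abel
  have h2 : (1 + p + q - p * q - q * p - q * p) * (1 + p + q - q * p) = 1 := by
    simp only [mul_add, add_mul, mul_sub, sub_mul, mul_assoc, hq', hp, hq,
      hpq1, hqp1, mul_zero, add_zero, one_mul, mul_one, sub_zero]
    abel
  have h0 := h.eq_zero_of_isUnit_sub he ⟨⟨_, _, h1, h2⟩, rfl⟩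
    (by rw [hsub]; exact ⟨⟨_, _, h2, h1⟩, rfl⟩)
  calc p = (p * q + q * p) * p := by rw [add_mul, hpq, mul_assoc, hp, mul_zero, add_zero]
    _ = 0 := by rw [h0, zero_mul]

theorem IsUnitUC.mem_jacobson_of_mul_self (h : IsUnitUC R) {a : R} (ha : a * a = 0) :
    a ∈ jacobson R := by
  by_contra hJ
  obtain ⟨y, hy0, hy⟩ := h.clean.exists_outer_inverse hJ
  have ha' : ∀ x, a * (a * x) = 0 := fun x => by rw [← mul_assoc, ha, zero_mul]
  have hy1 : y * (a * y) = y := by rw [← mul_assoc, hy]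
  have hy' : ∀ x, y * (a * (y * x)) = y * x := fun x => by simp only [← mul_assoc, hy]
  have h0 : a * y * a = 0 := by
    -- The correction a y² makes q square-zero; it is invisible in p q p because a² = 0.
    refine h.eq_zero_of_matrix_units (q := y - a * y * y) ?_ ?_ ?_ ?_ <;>
    simp only [mul_sub, sub_mul, mul_assoc, ha', hy', hy1, mul_zero, sub_zero, sub_self]
  refine hy0 ?_
  calc y = y * (a * y * a) * y := by simp only [mul_assoc, hy', hy1]
    _ = 0 := by rw [h0, mul_zero, zero_mul]

/-- The off-diagonal Peirce components of x square to zero, so they lie in the radical. -/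
theorem IsUnitUC.mk_isIdempotentElem_comm (h : IsUnitUC R) {e : R} (he : IsIdempotentElem e)
    (x : R) : Commute (Ideal.Quotient.mk (jacobson R) e) (Ideal.Quotient.mk (jacobson R) x) := by
  have h1 : e * x * (1 - e) ∈ jacobson R := h.mem_jacobson_of_mul_self <| by
    calc _ = e * x * ((1 - e) * e) * x * (1 - e) := by simp only [mul_assoc]
      _ = 0 := by simp only [he.one_sub_mul_self, mul_zero, zero_mul]
  have h2 : (1 - e) * x * e ∈ jacobson R := h.mem_jacobson_of_mul_self <| by
    calc _ = (1 - e) * x * (e * (1 - e)) * x * e := by simp only [mul_assoc]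
      _ = 0 := by simp only [he.mul_one_sub_self, mul_zero, zero_mul]
  rw [Commute, SemiconjBy, ← map_mul, ← map_mul, Ideal.Quotient.eq]
  convert! sub_mem h1 h2 using 1
  noncomm_ring

/-- A unit of a corner ring extends to a unit of the whole ring. -/
theorem IsIdempotentElem.isUnit_add_one_sub {e a b : R} (he : IsIdempotentElem e)
    (hea : e * a = a) (hae : a * e = a) (heb : e * b = b) (hbe : b * e = b)
    (hab : a * b = e) (hba : b * a = e) : IsUnit (a + (1 - e)) := by
  refine ⟨⟨a + (1 - e), b + (1 - e), ?_, ?_⟩, rfl⟩ <;>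
  simp only [mul_add, add_mul, mul_sub, sub_mul, hea, hae, heb, hbe, hab, hba, he.eq, mul_one,
    one_mul] <;>
  abel

/-- Otherwise 1 - u has an outer inverse y. Modulo J, f = y (1 - u) is a central idempotent in whose
corner both u and 1 - u are invertible. Then f u + (1 - f) is a unit that stays a unit after
subtracting f, so f = 0. -/
theorem IsUnitUC.one_sub_unit_mem_jacobson (h : IsUnitUC R) (u : Rˣ) :
    1 - (u : R) ∈ jacobson R := by
  by_contra hJ
  obtain ⟨y, hy0, hy⟩ := h.clean.exists_outer_inverse hJ
  have hf : IsIdempotentElem (y * (1 - u)) := by rw [IsIdempotentElem, ← mul_assoc, hy]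
  have hg : IsIdempotentElem ((1 - u) * y) := by
    rw [IsIdempotentElem, mul_assoc, ← mul_assoc y, hy]
  have cf := h.mk_isIdempotentElem_comm hf
  have cg := h.mk_isIdempotentElem_comm hg
  have hf0 : y * (1 - u) = 0 := by
    let π := Ideal.Quotient.mk (jacobson R)
    -- Centrality of both idempotents modulo J makes y a two-sided inverse of 1 - u in the corner.
    have hfg : π (y * (1 - u)) = π ((1 - u) * y) := by
      calc π (y * (1 - u)) = π y * π ((1 - u) * y) * π (1 - u) := by
            rw [← map_mul, ← map_mul]
            congr 1
            rw [← mul_assoc, hy]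
        _ = π ((1 - u) * y) * π (y * (1 - u)) := by
            rw [← (cg y).eq, mul_assoc, ← map_mul π y]
        _ = π (1 - u) * π (y * (1 - u)) * π y := by
            rw [mul_assoc (π (1 - u)), (cf y).eq, ← mul_assoc, ← map_mul π (1 - (u : R))]
        _ = π ((1 - u) * y) := by
            rw [← map_mul, ← map_mul]
            congr 1
            rw [mul_assoc, hy]
    have hF : IsIdempotentElem (π (y * (1 - u))) := hf.map π
    have hFY : π (y * (1 - u)) * π y = π y := by rw [← map_mul, hy]
    have hU : π ↑u * π ↑u⁻¹ = 1 := by rw [← map_mul, Units.mul_inv, map_one]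
    have hV : π ↑u⁻¹ * π ↑u = 1 := by rw [← map_mul, Units.inv_mul, map_one]
    have cu := cf u
    have cv := cf ↑u⁻¹
    have cy := cf y
    have cw := cf (1 - u)
    have hYW : π y * π (1 - u) = π (y * (1 - u)) := (map_mul π _ _).symm
    have hWY : π (1 - u) * π y = π (y * (1 - u)) := by rw [hfg, map_mul]
    refine h.eq_zero_of_isUnit_sub hf (u := y * (1 - u) * u + (1 - y * (1 - u)))
      (isUnit_of_isUnit_mk_jacobson ?_) (isUnit_of_isUnit_mk_jacobson ?_)
    · rw [map_add, map_sub, map_one, map_mul _ _ (u : R)]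
      change IsUnit (π (y * (1 - u)) * π u + (1 - π (y * (1 - u))))
      change Commute (π (y * (1 - u))) (π u) at cu
      change Commute (π (y * (1 - u))) (π ↑u⁻¹) at cv
      generalize π (y * (1 - u)) = F at *
      refine hF.isUnit_add_one_sub (b := F * π ↑u⁻¹) ?_ ?_ ?_ ?_ ?_ ?_
      · rw [← mul_assoc, hF.eq]
      · rw [mul_assoc, ← cu.eq, ← mul_assoc, hF.eq]
      · rw [← mul_assoc, hF.eq]
      · rw [mul_assoc, ← cv.eq, ← mul_assoc, hF.eq]
      · rw [cu.eq, mul_assoc, ← mul_assoc F, hF.eq, cv.eq, ← mul_assoc, hU, one_mul]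
      · rw [cv.eq, mul_assoc, ← mul_assoc F, hF.eq, cu.eq, ← mul_assoc, hV, one_mul]
    · have h1 : y * (1 - u) * u + (1 - y * (1 - u)) - y * (1 - u) =
          -(y * (1 - u) * (1 - u)) + (1 - y * (1 - u)) := by
        rw [mul_sub (y * (1 - (u : R))) 1 (u : R), mul_one]
        abel
      rw [h1, map_add, map_sub, map_one, map_neg, map_mul _ _ (1 - (u : R))]
      change IsUnit (-(π (y * (1 - u)) * π (1 - u)) + (1 - π (y * (1 - u))))
      change Commute (π (y * (1 - u))) (π (1 - u)) at cw
      change Commute (π (y * (1 - u))) (π y) at cy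
      generalize π (y * (1 - u)) = F at *
      refine hF.isUnit_add_one_sub (b := -π y) ?_ ?_ ?_ ?_ ?_ ?_
      · rw [mul_neg, ← mul_assoc, hF.eq]
      · rw [neg_mul, mul_assoc, ← cw.eq, ← mul_assoc, hF.eq]
      · rw [mul_neg, hFY]
      · rw [neg_mul, ← cy.eq, hFY]
      · rw [neg_mul_neg, mul_assoc, hWY, hF.eq]
      · rw [neg_mul_neg, ← mul_assoc, ← cy.eq, hFY, hYW]
  exact hy0 (by rw [← hy, hf0, zero_mul])

theorem IsUnitUC.isJacobsonClean (h : IsUnitUC R) : IsJacobsonClean R := fun a => by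
  obtain ⟨e, _, he, ⟨u, rfl⟩, hu⟩ := h.clean (a + 1)
  refine ⟨e, he, ?_⟩
  rw [show a - e = -(1 - (u : R)) from by rw [eq_sub_of_add_eq hu]; abel]
  exact neg_mem (h.one_sub_unit_mem_jacobson u)

theorem isUnitUC_iff_isJacobsonClean : IsUnitUC R ↔ IsJacobsonClean R :=
  ⟨IsUnitUC.isJacobsonClean, IsJacobsonClean.isUnitUC⟩

/-- The idempotents of a corner ring lift modulo the Jacobson radical. -/
theorem IsJacobsonClean.exists_corner (h : IsJacobsonClean R) {e x : R} (he : IsIdempotentElem e)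
    (hex : e * x = x) (hxe : x * e = x) :
    ∃ g, IsIdempotentElem g ∧ e * g = g ∧ g * e = g ∧ x - g ∈ jacobson R := by
  obtain ⟨f, hf, hj⟩ := h x
  have hxf : Ideal.Quotient.mk (jacobson R) x = Ideal.Quotient.mk (jacobson R) f :=
    Ideal.Quotient.eq.2 hj
  -- This unit w satisfies w f = e f, so w f w⁻¹ is fixed by e on the left; right multiplication by
  -- e then moves it into the corner.
  have hw1 : Ideal.Quotient.mk (jacobson R) (1 - (f - e * f)) = 1 := by
    rw [map_sub, map_sub, map_mul, ← hxf, ← map_mul, hex, sub_self, sub_zero, map_one]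
  obtain ⟨w, hw⟩ := isUnit_of_isUnit_mk_jacobson (hw1 ▸ isUnit_one)
  rw [← hw] at hw1
  have hw2 : Ideal.Quotient.mk (jacobson R) (↑w⁻¹ : R) = 1 := by
    calc _ = Ideal.Quotient.mk (jacobson R) (w : R) * Ideal.Quotient.mk (jacobson R) ↑w⁻¹ := by
          rw [hw1, one_mul]
      _ = 1 := by rw [← map_mul, Units.mul_inv, map_one]
  have hwf : w * f = e * f := by
    rw [hw, sub_mul, sub_mul, mul_assoc, hf.eq, one_mul, sub_sub_cancel]
  have hg : e * (w * f * ↑w⁻¹) = w * f * ↑w⁻¹ := by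
    rw [hwf, ← mul_assoc, ← mul_assoc, he.eq]
  have hgg : w * f * ↑w⁻¹ * (w * f * ↑w⁻¹) = w * f * ↑w⁻¹ := by
    simp only [mul_assoc, Units.inv_mul_cancel_left]
    rw [← mul_assoc f, hf.eq]
  refine ⟨w * f * ↑w⁻¹ * e, ?_, ?_, ?_, ?_⟩
  · rw [IsIdempotentElem, mul_assoc, ← mul_assoc e, hg, ← mul_assoc, hgg]
  · rw [← mul_assoc, hg]
  · rw [mul_assoc, he.eq]
  · rw [← Ideal.Quotient.eq, map_mul, map_mul, map_mul, hw1, hw2, one_mul, mul_one, ← hxf,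
      ← map_mul, hxe]

end Clean

/-! ### Passing between R and the formal matrix ring. -/

namespace FormalMatrix

variable {n : ℕ} {R : Type*} [Ring R] {s : Subring.center R}

/-- The formal matrix with entry `r` at `(i, j)` and zeros elsewhere. -/
def single (i j : Fin n) (r : R) : FormalMatrix n R s :=
  fun k l => if k = i ∧ l = j then r else 0

theorem single_apply (i j k l : Fin n) (r : R) :
    (single i j r : FormalMatrix n R s) k l = if k = i ∧ l = j then r else 0 := rfl

theorem sub_apply (a b : FormalMatrix n R s) (i j : Fin n) : (a - b) i j = a i j - b i j := rfl

theorem sum_apply {ι : Type*} (t : Finset ι) (a : ι → FormalMatrix n R s) (i j : Fin n) :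
    (∑ x ∈ t, a x) i j = ∑ x ∈ t, a x i j :=
  Matrix.sum_apply i j t a

theorem mul_single_apply (a : FormalMatrix n R s) (i k l : Fin n) (r : R) :
    (a * single i i r : FormalMatrix n R s) k l = if l = i then a k i * r else 0 := by
  rw [mul_apply, Finset.sum_eq_single i]
  · split_ifs with h
    · subst h
      simp [single_apply, deltaExp_self_right]
    · simp [single_apply, h]
  · intro j _ hj
    simp [single_apply, hj]
  · simp

theorem single_mul_apply (a : FormalMatrix n R s) (i k l : Fin n) (r : R) :
    (single i i r * a : FormalMatrix n R s) k l = if k = i then r * a i l else 0 := by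
  rw [mul_apply, Finset.sum_eq_single i]
  · split_ifs with h
    · subst h
      simp [single_apply, deltaExp_self_left]
    · simp [single_apply, h]
  · intro j _ hj
    simp [single_apply, hj]
  · simp

theorem single_add (i j : Fin n) (a b : R) :
    (single i j (a + b) : FormalMatrix n R s) = single i j a + single i j b := by
  apply ext
  intro k l
  rw [add_apply]
  simp only [single_apply]
  split_ifs <;> simp

theorem single_mul_mul_single (i : Fin n) (x y : R) (a : FormalMatrix n R s) :
    single i i x * a * single i i y = single i i (x * a i i * y) := by
  apply ext
  intro k l
  rw [mul_single_apply, single_mul_apply, single_apply]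
  by_cases hl : l = i <;> by_cases hk : k = i <;> simp [hl, hk]

theorem single_mul_single (i : Fin n) (a b : R) :
    (single i i a * single i i b : FormalMatrix n R s) = single i i (a * b) := by
  have h := single_mul_mul_single i a b (1 : FormalMatrix n R s)
  rwa [mul_one, one_apply, if_pos rfl, mul_one] at h

theorem single_one_mul_single_one {i j : Fin n} (h : i ≠ j) :
    (single i j 1 * single j i 1 : FormalMatrix n R s) = single i i ((s : R) ^ 2) := by
  have hd : deltaExp i j i = 2 := by simp [deltaExp, kronecker, h, h.symm]
  apply ext
  intro k l
  rw [mul_apply, Finset.sum_eq_single j]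
  · by_cases hl : l = i <;> by_cases hk : k = i <;> simp [single_apply, hl, hk, hd]
  · intro m _ hm
    simp [single_apply, hm]
  · simp

theorem single_mul_self {i j : Fin n} (h : i ≠ j) (r : R) :
    (single i j r * single i j r : FormalMatrix n R s) = 0 := by
  apply ext
  intro k l
  rw [mul_apply, zero_apply]
  refine Finset.sum_eq_zero fun m _ => ?_
  by_cases hm : m = i
  · simp [single_apply, hm, h]
  · simp [single_apply, hm]

theorem apply_mem_jacobson {a : FormalMatrix n R s} (ha : a ∈ jacobson (FormalMatrix n R s))
    (i : Fin n) : a i i ∈ jacobson R := by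
  rw [mem_jacobson_iff_exists_left_inv]
  intro y
  have ha' := Ideal.mul_mem_right (single i i 1) _ ha
  obtain ⟨z, hz⟩ := mem_jacobson_iff_exists_left_inv.1 ha' (single i i y)
  refine ⟨z i i, ?_⟩
  rw [← mul_assoc, single_mul_mul_single, mul_one, mul_add, mul_one] at hz
  have h := congrArg (fun m : FormalMatrix n R s => m i i) hz
  simpa only [add_apply, mul_single_apply, one_apply, if_pos, mul_add, mul_one] using h

/-- If `s` lies in the Jacobson radical, then so does each formal matrix with at most one nonzero
column whose diagonal entry lies in the Jacobson radical. -/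
theorem mul_single_mem_jacobson (hs : (s : R) ∈ jacobson R) {a : FormalMatrix n R s} {i : Fin n}
    (ha : a i i ∈ jacobson R) : a * single i i 1 ∈ jacobson (FormalMatrix n R s) := by
  rw [mem_jacobson_iff_exists_left_inv]
  intro y
  rw [← mul_assoc]
  have hb : (y * a) i i ∈ jacobson R := by
    rw [mul_apply]
    refine sum_mem fun k _ => ?_
    by_cases hk : k = i
    · subst hk
      exact Ideal.mul_mem_left _ _ ha
    · have hd : deltaExp i k i = 2 := by simp [deltaExp, kronecker, hk, Ne.symm hk]
      rw [mul_assoc, hd, pow_two]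
      exact Ideal.mul_mem_right _ _ (Ideal.mul_mem_left _ _ hs)
  generalize y * a = b at hb
  obtain ⟨c, hc⟩ := isUnit_one_add_of_mem_jacobson hb
  have h1 : (single i i 1 : FormalMatrix n R s) =
      single i i (↑c⁻¹ : R) + single i i (↑c⁻¹ : R) * b * single i i 1 := by
    rw [single_mul_mul_single, ← single_add]
    congr 1
    rw [mul_one, ← mul_one_add, ← hc, Units.inv_mul]
  -- This is (1 + b E)⁻¹ = 1 - b (1 + E b E)⁻¹ E, inverting only the entry c = 1 + b_ii.
  refine ⟨1 - b * single i i (↑c⁻¹ : R), ?_⟩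
  calc (1 - b * single i i (↑c⁻¹ : R)) * (1 + b * single i i 1)
      = 1 + b * single i i 1 -
        b * (single i i (↑c⁻¹ : R) + single i i (↑c⁻¹ : R) * b * single i i 1) := by
        noncomm_ring
    _ = 1 := by rw [← h1, add_sub_cancel_right]

theorem isJacobsonClean (hs : (s : R) ∈ jacobson R) (h : IsJacobsonClean R) :
    IsJacobsonClean (FormalMatrix n R s) := fun a => by
  choose e he hj using fun i => h (a i i)
  let d : FormalMatrix n R s := fun i j => if i = j then e i else 0
  have hd : ∀ i j, d i j = if i = j then e i else 0 := fun _ _ => rfl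
  refine ⟨d, ?_, ?_⟩
  · apply ext
    intro i j
    rw [mul_apply, Finset.sum_eq_single i]
    · rw [deltaExp_self_left, hd, hd, if_pos rfl, pow_zero, one_mul, mul_ite, (he i).eq, mul_zero]
    · intro k _ hk
      rw [hd, if_neg hk.symm, mul_zero, zero_mul]
    · simp
  · have h1 : a - d = ∑ i, (a - d) * single i i 1 := by
      apply ext
      intro k l
      simp [sum_apply, mul_single_apply]
    rw [h1]
    refine sum_mem fun i _ => mul_single_mem_jacobson hs ?_
    rw [sub_apply, hd, if_pos rfl]
    exact hj i

theorem isJacobsonClean_of_formalMatrix (i : Fin n) (h : IsJacobsonClean (FormalMatrix n R s)) :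
    IsJacobsonClean R := fun a => by
  have hE : IsIdempotentElem (single i i 1 : FormalMatrix n R s) := by
    rw [IsIdempotentElem, single_mul_single, mul_one]
  obtain ⟨g, hg, h1, h2, hj⟩ := h.exists_corner hE (x := single i i a)
    (by rw [single_mul_single, one_mul]) (by rw [single_mul_single, mul_one])
  have h3 : g = single i i (g i i) := by
    have h4 := single_mul_mul_single i 1 1 g
    rwa [h1, h2, one_mul, mul_one] at h4
  refine ⟨g i i, ?_, ?_⟩
  · rw [IsIdempotentElem, h3, single_mul_single] at hg
    have h4 := congrArg (fun m : FormalMatrix n R s => m i i) hg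
    simpa [single_apply, IsIdempotentElem] using h4
  · simpa [sub_apply, single_apply] using apply_mem_jacobson hj i

theorem mem_jacobson_of_isJacobsonClean {i j : Fin n} (hij : i ≠ j)
    (h : IsJacobsonClean (FormalMatrix n R s)) : (s : R) ∈ jacobson R := by
  have h1 : (single i j 1 : FormalMatrix n R s) ∈ jacobson (FormalMatrix n R s) := by
    -- In a Boolean quotient each element equals its square, so square-zero elements vanish there.
    rw [← mk_jacobson_eq_zero, ← (h.isIdempotentElem_mk _).eq, ← map_mul, single_mul_self hij,
      map_zero]
  have h2 := apply_mem_jacobson (Ideal.mul_mem_right (single j i 1) _ h1) i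
  rw [single_one_mul_single_one hij, single_apply, if_pos ⟨rfl, rfl⟩, ← mk_jacobson_eq_zero,
    pow_two, map_mul, ((isJacobsonClean_of_formalMatrix i h).isIdempotentElem_mk _).eq,
    mk_jacobson_eq_zero] at h2
  exact h2

end FormalMatrix

theorem mainTheorem7 {R : Type*} [Ring R] (s : R) (hs : s ∈ Subring.center R)
    (n : ℕ) (hn : 2 ≤ n) :
    IsUnitUC (FormalMatrix n R ⟨s, hs⟩) ↔ IsUnitUC R ∧ s ∈ Ring.jacobson R := by
  rw [isUnitUC_iff_isJacobsonClean, isUnitUC_iff_isJacobsonClean]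
  have h01 : (⟨0, by omega⟩ : Fin n) ≠ ⟨1, by omega⟩ := by simp
  exact ⟨fun h => ⟨FormalMatrix.isJacobsonClean_of_formalMatrix ⟨0, by omega⟩ h,
    FormalMatrix.mem_jacobson_of_isJacobsonClean h01 h⟩,
    fun h => FormalMatrix.isJacobsonClean h.2 h.1⟩
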